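/- Let $G$ be a finite group. Say that $G$ realizes $\langle n_1,n_2,n_3\rangle$ if there are subsets $S_1,S_2,S_3\subseteq G$ with $|S_i|=n_i$ such that, whenever $q_i\in Q(S_i)=\{st^{-1}: s,t\in S_i\}$ for $i=1,2,3$ and $q_1q_2q_3=1$, one has $q_1=q_2=q_3=1$. For non-trivial $G$, let the pseudo-exponent $\alpha=\alpha(G)$ be the minimum of $\frac{3\log|G|}{\log (nmp)}$ over all positive integers $n,m,p$, not all equal to $1$, such that $G$ realizes $\langle n,m,p\rangle$; for trivial $G$ put $\alpha(G)=3$. Define $\gamma=\gamma(G)\in(0,\infty]$ so that $|G|^{1/\gamma}$ is the largest character degree of $G$, i.e. the largest dimension of an irreducible complex representation of $G$, with $\gamma(G)=\infty$ if $G$ is abelian. Let $\omega$ be the exponent of matrix multiplication over $\mathbb{C}$, i.e. the infimum of all real $\tau$ such that two $n\times n$ complex matrices can be multiplied with $O(n^{\tau})$ field operations. If $\alpha(G)<\gamma(G)$, then $$\omega\le\alpha\left(\frac{\gamma-2}{\gamma-\alpha}\right),$$ where for $\gamma=\infty$ the right-hand side is understood as its limit $\alpha$. -/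

import Mathlib

/-! ### Arithmetic complexity and the exponent of matrix multiplication -/

/-- `ArithComputation A s S`: starting from the set `A` of freely available functions on an input
space `X`, some straight-line program that carries out exactly `s` field operations
(additions, subtractions, multiplications and divisions, each applied to two functions that are
already available) makes exactly the functions in `S` available.  A division is allowed only if
the divisor does not vanish at any input, so that the program runs correctly on every input. -/
inductive ArithComputation {X : Type} (A : Set (X → ℂ)) : ℕ → Set (X → ℂ) → Prop
  | start : ArithComputation A 0 A
  | add {s : ℕ} {S : Set (X → ℂ)} {f g : X → ℂ} (hS : ArithComputation A s S) (hf : f ∈ S)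
      (hg : g ∈ S) : ArithComputation A (s + 1) (insert (fun x => f x + g x) S)
  | sub {s : ℕ} {S : Set (X → ℂ)} {f g : X → ℂ} (hS : ArithComputation A s S) (hf : f ∈ S)
      (hg : g ∈ S) : ArithComputation A (s + 1) (insert (fun x => f x - g x) S)
  | mul {s : ℕ} {S : Set (X → ℂ)} {f g : X → ℂ} (hS : ArithComputation A s S) (hf : f ∈ S)
      (hg : g ∈ S) : ArithComputation A (s + 1) (insert (fun x => f x * g x) S)
  | div {s : ℕ} {S : Set (X → ℂ)} {f g : X → ℂ} (hS : ArithComputation A s S) (hf : f ∈ S)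
      (hg : g ∈ S) (hne : ∀ x, g x ≠ 0) :
      ArithComputation A (s + 1) (insert (fun x => f x / g x) S)

/-- A pair of complex `n × n` matrices. -/
abbrev MatrixPair (n : ℕ) : Type := Matrix (Fin n) (Fin n) ℂ × Matrix (Fin n) (Fin n) ℂ

/-- What a program for `n × n` matrix multiplication may use for free: the entries of the two
matrices, and the complex constants. -/
def matMulInputs (n : ℕ) : Set (MatrixPair n → ℂ) :=
  {f | (∃ i j, f = fun p => p.1 i j) ∨ (∃ i j, f = fun p => p.2 i j) ∨ ∃ c : ℂ, f = fun _ => c}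

/-- Two complex `n × n` matrices can be multiplied with `s` field operations. -/
def CanMultiplyIn (n s : ℕ) : Prop :=
  ∃ S : Set (MatrixPair n → ℂ), ArithComputation (matMulInputs n) s S ∧
    ∀ i j, (fun p : MatrixPair n => (p.1 * p.2) i j) ∈ S

/-- The real numbers `τ` such that `n × n` matrices over `ℂ` can be multiplied with `O(n ^ τ)`
field operations. -/
def matMulExponents : Set ℝ :=
  {τ | ∃ C : ℝ, ∀ n : ℕ, 1 ≤ n → ∃ s : ℕ, (s : ℝ) ≤ C * (n : ℝ) ^ τ ∧ CanMultiplyIn n s}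

/-- The exponent `ω` of matrix multiplication over `ℂ`. -/
noncomputable def matMulExponent : ℝ := sInf matMulExponents

theorem ArithComputation.exists_dot {n : ℕ} {s : ℕ} {S : Set (MatrixPair n → ℂ)}
    (hS : ArithComputation (matMulInputs n) s S) (hA : matMulInputs n ⊆ S) (i j : Fin n)
    (T : Finset (Fin n)) :
    ∃ S', S ⊆ S' ∧ ArithComputation (matMulInputs n) (s + T.card * 2) S' ∧
      (fun p : MatrixPair n => ∑ k ∈ T, p.1 i k * p.2 k j) ∈ S' := by
  classical
  induction T using Finset.induction_on with
  | empty =>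
    refine ⟨S, subset_rfl, by simpa using hS, hA (Or.inr (Or.inr ⟨0, ?_⟩))⟩
    simp
  | insert a T ha ih =>
    obtain ⟨S', h1, h2, h3⟩ := ih
    have h4 := ArithComputation.mul h2 (f := fun p => p.1 i a) (g := fun p => p.2 a j)
      (h1 (hA (Or.inl ⟨i, a, rfl⟩))) (h1 (hA (Or.inr (Or.inl ⟨a, j, rfl⟩))))
    have h5 := ArithComputation.add h4 (Set.mem_insert _ _) (Set.mem_insert_of_mem _ h3)
    have hfun : (fun p : MatrixPair n => ∑ k ∈ insert a T, p.1 i k * p.2 k j) =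
        fun p => p.1 i a * p.2 a j + ∑ k ∈ T, p.1 i k * p.2 k j := by
      funext p
      rw [Finset.sum_insert ha]
    rw [Finset.card_insert_of_notMem ha, add_mul, one_mul, ← add_assoc, hfun]
    exact ⟨_, (h1.trans (Set.subset_insert _ _)).trans (Set.subset_insert _ _), h5,
      Set.mem_insert _ _⟩

/-- The school method. -/
theorem canMultiplyIn_naive (n : ℕ) : CanMultiplyIn n (2 * n ^ 3) := by
  classical
  have key : ∀ U : Finset (Fin n × Fin n), ∃ S, matMulInputs n ⊆ S ∧
      ArithComputation (matMulInputs n) (U.card * (n * 2)) S ∧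
      ∀ q ∈ U, (fun p : MatrixPair n => (p.1 * p.2) q.1 q.2) ∈ S := by
    intro U
    induction U using Finset.induction_on with
    | empty => exact ⟨_, subset_rfl, by simpa using ArithComputation.start, by simp⟩
    | insert a U ha ih =>
      obtain ⟨S, h1, h2, h3⟩ := ih
      obtain ⟨S', h4, h5, h6⟩ := h2.exists_dot h1 a.1 a.2 Finset.univ
      refine ⟨S', h1.trans h4, ?_, ?_⟩
      · rw [Finset.card_insert_of_notMem ha, add_mul, one_mul]
        simpa using h5
      · intro q hq
        rcases Finset.mem_insert.1 hq with rfl | hq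
        · simpa only [Matrix.mul_apply] using h6
        · exact h4 (h3 q hq)
  obtain ⟨S, -, h2, h3⟩ := key Finset.univ
  refine ⟨S, ?_, fun i j => h3 (i, j) (Finset.mem_univ _)⟩
  have : 2 * n ^ 3 = (Finset.univ : Finset (Fin n × Fin n)).card * (n * 2) := by
    simp; ring
  rw [this]
  exact h2

theorem three_mem_matMulExponents : (3 : ℝ) ∈ matMulExponents := by
  refine ⟨2, fun n _ => ⟨2 * n ^ 3, ?_, canMultiplyIn_naive n⟩⟩
  norm_cast

theorem not_canMultiplyIn_zero {n : ℕ} (hn : 1 ≤ n) : ¬ CanMultiplyIn n 0 := by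
  rintro ⟨S, hS, h⟩
  have hA : S = matMulInputs n := by
    cases hS
    rfl
  subst hA
  let i : Fin n := ⟨0, hn⟩
  have hv : ∀ c : ℂ, ((c • (1 : Matrix (Fin n) (Fin n) ℂ)) * (c • 1)) i i = c * c := by
    intro c; simp
  rcases h i i with ⟨a, b, hf⟩ | ⟨a, b, hf⟩ | ⟨c, hf⟩
  · have h1 := congrFun hf ((1 : ℂ) • 1, (1 : ℂ) • 1)
    have h2 := congrFun hf ((2 : ℂ) • 1, (2 : ℂ) • 1)
    simp only [hv, Matrix.smul_apply, smul_eq_mul] at h1 h2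
    rw [one_mul, one_mul] at h1
    rw [← h1] at h2
    norm_num at h2
  · have h1 := congrFun hf ((1 : ℂ) • 1, (1 : ℂ) • 1)
    have h2 := congrFun hf ((2 : ℂ) • 1, (2 : ℂ) • 1)
    simp only [hv, Matrix.smul_apply, smul_eq_mul] at h1 h2
    rw [one_mul, one_mul] at h1
    rw [← h1] at h2
    norm_num at h2
  · have h1 := congrFun hf ((1 : ℂ) • 1, (1 : ℂ) • 1)
    have h2 := congrFun hf ((2 : ℂ) • 1, (2 : ℂ) • 1)
    simp only [hv] at h1 h2
    rw [← h1] at h2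
    norm_num at h2

theorem bddBelow_matMulExponents : BddBelow matMulExponents := by
  refine ⟨0, ?_⟩
  rintro τ ⟨C, hC⟩
  by_contra! hτ
  have ht : Filter.Tendsto (fun n : ℕ => C * (n : ℝ) ^ τ) Filter.atTop (nhds (C * 0)) := by
    have h := (tendsto_rpow_neg_atTop (y := -τ) (by linarith)).comp
      (tendsto_natCast_atTop_atTop (R := ℝ))
    simp only [neg_neg] at h
    exact h.const_mul C
  rw [mul_zero] at ht
  obtain ⟨n, h1, h2⟩ := ((ht.eventually (gt_mem_nhds one_pos)).and
    (Filter.eventually_ge_atTop 1)).exists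
  obtain ⟨s, hs, hm⟩ := hC n h2
  have : s = 0 := by
    have : (s : ℝ) < 1 := hs.trans_lt h1
    have : s < 1 := by exact_mod_cast this
    omega
  exact not_canMultiplyIn_zero h2 (this ▸ hm)

/-! ### The triple product property and the pseudo-exponent -/

/-- The right quotient set `Q(S) = {s₁ s₂⁻¹ : s₁, s₂ ∈ S}`. -/
def rightQuotientSet {G : Type*} [Group G] (S : Finset G) : Set G :=
  {q | ∃ s₁ ∈ S, ∃ s₂ ∈ S, q = s₁ * s₂⁻¹}

def TripleProductProperty {G : Type*} [Group G] (S₁ S₂ S₃ : Finset G) : Prop :=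
  ∀ q₁ ∈ rightQuotientSet S₁, ∀ q₂ ∈ rightQuotientSet S₂, ∀ q₃ ∈ rightQuotientSet S₃,
    q₁ * q₂ * q₃ = 1 → q₁ = 1 ∧ q₂ = 1 ∧ q₃ = 1

/-- `G` realizes `⟨n₁, n₂, n₃⟩`. -/
def Realizes (G : Type*) [Group G] (n₁ n₂ n₃ : ℕ) : Prop :=
  ∃ S₁ S₂ S₃ : Finset G, S₁.card = n₁ ∧ S₂.card = n₂ ∧ S₃.card = n₃ ∧
    TripleProductProperty S₁ S₂ S₃

/-- The numbers `3 log |G| / log (nmp)`, where `n, m, p` are positive and not all `1` (that is,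
`nmp > 1`) and `G` realizes `⟨n, m, p⟩`. -/
def pseudoExponentValues (G : Type*) [Group G] : Set ℝ :=
  {a | ∃ n m p : ℕ, 1 < n * m * p ∧ Realizes G n m p ∧
    a = 3 * Real.log (Nat.card G) / Real.log ((n * m * p : ℕ) : ℝ)}

open Classical in
/-- The pseudo-exponent `α(G)` of a finite group: the minimum of the above numbers if `G` is
non-trivial, and `3` if `G` is trivial. -/
noncomputable def pseudoExponent (G : Type*) [Group G] : ℝ :=
  if Nontrivial G then sInf (pseudoExponentValues G) else 3

theorem pseudoExponent_isLeast (G : Type*) [Group G] [Finite G] [Nontrivial G] :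
    IsLeast (pseudoExponentValues G) (pseudoExponent G) := by
  classical
  have := Fintype.ofFinite G
  have hfin : (pseudoExponentValues G).Finite := by
    let F : ℕ × ℕ × ℕ → ℝ := fun t =>
      3 * Real.log (Nat.card G) / Real.log ((t.1 * t.2.1 * t.2.2 : ℕ) : ℝ)
    let N := Fintype.card G
    refine (((Set.finite_Iic N).prod ((Set.finite_Iic N).prod (Set.finite_Iic N))).image
      F).subset ?_
    rintro a ⟨n, m, p, -, ⟨S₁, S₂, S₃, rfl, rfl, rfl, -⟩, rfl⟩
    exact ⟨(S₁.card, S₂.card, S₃.card),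
      ⟨S₁.card_le_univ, S₂.card_le_univ, S₃.card_le_univ⟩, rfl⟩
  have hne : (pseudoExponentValues G).Nonempty := by
    refine ⟨_, 1, 1, Nat.card G, ?_, ⟨{1}, {1}, Finset.univ, by simp, by simp, by simp, ?_⟩, rfl⟩
    · simpa using Finite.one_lt_card (α := G)
    · rintro q₁ ⟨a, ha, b, hb, rfl⟩ q₂ ⟨c, hc, d, hd, rfl⟩ q₃ - h
      simp_all
  rw [pseudoExponent, if_pos (inferInstance : Nontrivial G)]
  exact ⟨hne.csInf_mem hfin, fun a ha => csInf_le hfin.bddBelow ha⟩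

/-! ### Character degrees -/

/-- The character degrees of `G`: the dimensions of its irreducible complex representations. -/
def characterDegrees (G : Type*) [Group G] : Set ℕ :=
  {d | ∃ ρ : Representation ℂ G (Fin d → ℂ), ρ.IsIrreducible}

/-- The largest character degree of a finite group. -/
noncomputable def maxCharacterDegree (G : Type*) [Group G] : ℕ := sSup (characterDegrees G)

open Classical in
/-- `γ(G)`, the element of `(0, ∞]` with `|G| ^ (1 / γ(G))` equal to the largest character
degree; it is `∞` if `G` is abelian. -/
noncomputable def degreeExponent (G : Type*) [Group G] : EReal :=
  if ∀ a b : G, a * b = b * a then ⊤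
  else ((Real.log (Nat.card G) / Real.log (maxCharacterDegree G) : ℝ) : EReal)

theorem bddAbove_characterDegrees (G : Type*) [Group G] [Finite G] :
    BddAbove (characterDegrees G) := by
  have := Fintype.ofFinite G
  refine ⟨Fintype.card G, ?_⟩
  rintro d ⟨ρ, hρ⟩
  have hnt : Nontrivial (Fin d → ℂ) := by
    by_contra hcon
    rw [not_nontrivial_iff_subsingleton] at hcon
    have := hρ.toNontrivial
    obtain ⟨x, y, hxy⟩ := exists_pair_ne (Subrepresentation ρ)
    refine hxy (SetLike.ext fun v => ?_)
    rw [Subsingleton.elim v 0]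
    exact ⟨fun _ => y.toSubmodule.zero_mem, fun _ => x.toSubmodule.zero_mem⟩
  obtain ⟨v, hv⟩ := exists_ne (0 : Fin d → ℂ)
  let W : Subrepresentation ρ :=
    { toSubmodule := Submodule.span ℂ (Set.range fun g => ρ g v)
      apply_mem_toSubmodule := by
        intro g w hw
        induction hw using Submodule.span_induction with
        | mem x hx =>
          obtain ⟨h, rfl⟩ := hx
          exact Submodule.subset_span ⟨g * h, by simp⟩
        | zero => simp
        | add x y _ _ hx hy => rw [map_add]; exact Submodule.add_mem _ hx hy
        | smul c x _ hx => rw [map_smul]; exact Submodule.smul_mem _ c hx }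
  have hvW : v ∈ W.toSubmodule := Submodule.subset_span ⟨1, by simp⟩
  have hW : W = ⊤ := by
    rcases hρ.eq_bot_or_eq_top W with h | h
    · rw [h] at hvW
      exact absurd hvW hv
    · exact h
  have hspan : Submodule.span ℂ (Set.range fun g => ρ g v) = ⊤ :=
    congrArg Subrepresentation.toSubmodule hW
  have := finrank_range_le_card (R := ℂ) (fun g => ρ g v)
  rw [Set.finrank, hspan] at this
  simpa using this

theorem one_mem_characterDegrees (G : Type*) [Group G] : 1 ∈ characterDegrees G := by
  refine ⟨1, ?_⟩
  have hbt : ∀ W : Submodule ℂ (Fin 1 → ℂ), W = ⊥ ∨ W = ⊤ := by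
    have : IsSimpleModule ℂ (Fin 1 → ℂ) :=
      IsSimpleModule.congr (LinearEquiv.funUnique (Fin 1) ℂ ℂ)
    exact fun W => eq_bot_or_eq_top W
  refine { exists_pair_ne := ⟨⊥, ⊤, fun h => ?_⟩, eq_bot_or_eq_top := fun W => ?_ }
  · have h' : (⊥ : Submodule ℂ (Fin 1 → ℂ)) = ⊤ := congrArg Subrepresentation.toSubmodule h
    exact bot_ne_top h'
  · rcases hbt W.toSubmodule with h | h
    · left
      refine SetLike.ext fun v => ?_
      change v ∈ W.toSubmodule ↔ v ∈ (⊥ : Submodule ℂ (Fin 1 → ℂ))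
      rw [h]
    · right
      refine SetLike.ext fun v => ?_
      change v ∈ W.toSubmodule ↔ v ∈ (⊤ : Submodule ℂ (Fin 1 → ℂ))
      rw [h]

theorem card_rpow_inv_degreeExponent (G : Type*) [Group G] [Finite G]
    (hG : ¬ ∀ a b : G, a * b = b * a) :
    (Nat.card G : ℝ) ^ (1 / (degreeExponent G).toReal) = maxCharacterDegree G := by
  have hnt : Nontrivial G := by
    push Not at hG
    obtain ⟨a, b, hab⟩ := hG
    exact ⟨_, _, hab⟩
  have hc : 1 < Nat.card G := Finite.one_lt_card
  have hlog : Real.log (Nat.card G) ≠ 0 := (Real.log_pos (by exact_mod_cast hc)).ne'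
  have hd : 1 ≤ maxCharacterDegree G :=
    le_csSup (bddAbove_characterDegrees G) (one_mem_characterDegrees G)
  rw [degreeExponent, if_neg hG, EReal.toReal_coe,
    Real.rpow_def_of_pos (by exact_mod_cast (by omega : 0 < Nat.card G)), one_div_div,
    mul_div_cancel₀ _ hlog, Real.exp_log (by exact_mod_cast hd)]

/-! A triple with the triple product property embeds the product of an $n\times m$ and an $m\times
p$ matrix into the multiplication of $\mathbb{C}[G]\cong\prod_i M_{d_i}(\mathbb{C})$, so its
bilinear rank is at most the sum of the ranks of $d_i\times d_i$ multiplications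
(`TripleProductProperty.bilinRankLE`). Put $M=nmp$. Combining the three rotations of the triple and
passing to powers $G^{3l}$ gives square matrices of size $M^l$. As $l\to\infty$ constants disappear
and $M^\omega\le(\sum_i d_i^\tau)^3$ for every admissible $\tau$
(`Realizes.rpow_matMulExponent_le`).

Bounding $\sum_i d_i^\tau\le d_{\max}^{\tau-2}\sum_i d_i^2=d_{\max}^{\tau-2}|G|$ and letting $\tau$
tend to $\omega$ yields $\omega\log M\le 3((\omega-2)\log d_{\max}+\log|G|)$. With $\alpha\log
M=3\log|G|$ and $\gamma\log d_{\max}=\log|G|$ this is $\omega(\gamma-\alpha)\le\alpha(\gamma-2)$.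

Since $\omega$ counts all field operations, rank and program length must be compared both ways: a
program of length $s$ gives rank at most $2s$ (`CanMultiplyIn.matMulRankLE`), and a rank bound gives
recursive programs (`MatMulRankLE.logb_mem_matMulExponents`). The case $\omega\le2$ needs only
$\alpha\ge2$, and the abelian case only $\omega\le3\le\alpha$. -/

/-! ### Bilinear rank -/

/-- `φ` is a sum of `r` products of a linear form in the first argument, a linear form in the
second argument and a fixed vector. -/
def BilinRankLE {U V W : Type*} [AddCommGroup U] [Module ℂ U] [AddCommGroup V] [Module ℂ V]
    [AddCommGroup W] [Module ℂ W] (φ : U → V → W) (r : ℕ) : Prop :=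
  ∃ (u : Fin r → U →ₗ[ℂ] ℂ) (v : Fin r → V →ₗ[ℂ] ℂ) (w : Fin r → W),
    ∀ x y, φ x y = ∑ k, (u k x * v k y) • w k

namespace BilinRankLE

variable {U V W U' V' W' : Type*} [AddCommGroup U] [Module ℂ U] [AddCommGroup V] [Module ℂ V]
  [AddCommGroup W] [Module ℂ W] [AddCommGroup U'] [Module ℂ U'] [AddCommGroup V'] [Module ℂ V']
  [AddCommGroup W'] [Module ℂ W']

theorem of_fintype {φ : U → V → W} {ι : Type*} [Fintype ι] (u : ι → U →ₗ[ℂ] ℂ)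
    (v : ι → V →ₗ[ℂ] ℂ) (w : ι → W) (h : ∀ x y, φ x y = ∑ k, (u k x * v k y) • w k) :
    BilinRankLE φ (Fintype.card ι) := by
  let e := (Fintype.equivFin ι).symm
  refine ⟨u ∘ e, v ∘ e, w ∘ e, fun x y => ?_⟩
  rw [h, ← e.sum_comp]
  rfl

theorem mono {φ : U → V → W} {r r' : ℕ} (h : BilinRankLE φ r) (hr : r ≤ r') :
    BilinRankLE φ r' := by
  obtain ⟨u, v, w, h⟩ := h
  have := of_fintype (φ := φ) (ι := Fin r ⊕ Fin (r' - r)) (Sum.elim u 0) (Sum.elim v 0)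
    (Sum.elim w 0) (fun x y => by simp [h])
  rwa [Fintype.card_sum, Fintype.card_fin, Fintype.card_fin, Nat.add_sub_cancel' hr] at this

theorem comp {φ : U → V → W} {r : ℕ} (h : BilinRankLE φ r) (f : U' →ₗ[ℂ] U) (g : V' →ₗ[ℂ] V)
    (k : W →ₗ[ℂ] W') : BilinRankLE (fun x y => k (φ (f x) (g y))) r := by
  obtain ⟨u, v, w, h⟩ := h
  exact ⟨fun i => u i ∘ₗ f, fun i => v i ∘ₗ g, fun i => k (w i), fun x y => by simp [h]⟩

theorem sum {ι : Type*} [Fintype ι] {φ : ι → U → V → W} {r : ι → ℕ}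
    (h : ∀ i, BilinRankLE (φ i) (r i)) :
    BilinRankLE (fun x y => ∑ i, φ i x y) (∑ i, r i) := by
  choose u v w h using h
  have := of_fintype (φ := fun x y => ∑ i, φ i x y) (ι := Σ i, Fin (r i)) (fun p => u p.1 p.2)
    (fun p => v p.1 p.2) (fun p => w p.1 p.2) (fun x y => by
      rw [Fintype.sum_sigma]
      exact Finset.sum_congr rfl fun i _ => h i x y)
  simpa using this

end BilinRankLE

/-- The multiplication of square matrices with rows and columns indexed by `ι` has bilinear rank
at most `r`. -/
def MatMulRankLE (ι : Type*) [Fintype ι] (r : ℕ) : Prop :=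
  BilinRankLE (fun A B : Matrix ι ι ℂ => A * B) r

/-- The bilinear rank depends only on the size of the index type. -/
theorem MatMulRankLE.of_equiv {ι κ : Type*} [Fintype ι] [Fintype κ] {r : ℕ}
    (h : MatMulRankLE ι r) (e : κ ≃ ι) : MatMulRankLE κ r := by
  classical
  have := BilinRankLE.comp h (Matrix.reindexLinearEquiv ℂ ℂ e e).toLinearMap
    (Matrix.reindexLinearEquiv ℂ ℂ e e).toLinearMap
    (Matrix.reindexLinearEquiv ℂ ℂ e.symm e.symm).toLinearMap
  unfold MatMulRankLE
  convert this using 3 with A B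
  ext i j
  simp [Matrix.mul_apply, ← e.symm.sum_comp]

/-! ### From programs to bilinear rank -/

/-- A family of functions whose second-order behaviour at the origin is controlled by the
products in `Q`. -/
def QuadraticPartIn {V : Type*} [AddCommGroup V] [Module ℂ V] (Q : Set (V → ℂ)) (f : V → ℂ) :
    Prop :=
  ∃ (c : ℂ) (l : V →ₗ[ℂ] ℂ), ∃ q ∈ Submodule.span ℂ Q, ∀ x, ∃ p : Polynomial ℂ,
    (∀ t : ℂ, f (t • x) = p.eval t) ∧ p.coeff 0 = c ∧ p.coeff 1 = l x ∧ p.coeff 2 = q x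

namespace QuadraticPartIn

variable {V : Type*} [AddCommGroup V] [Module ℂ V] {Q : Set (V → ℂ)} {f g : V → ℂ}

theorem mono {Q' : Set (V → ℂ)} (hf : QuadraticPartIn Q f) (h : Q ⊆ Q') :
    QuadraticPartIn Q' f := by
  obtain ⟨c, l, q, hq, hp⟩ := hf
  exact ⟨c, l, q, Submodule.span_mono h hq, hp⟩

theorem const (Q : Set (V → ℂ)) (c : ℂ) : QuadraticPartIn Q fun _ => c :=
  ⟨c, 0, 0, zero_mem _, fun x => ⟨Polynomial.C c, by simp [Polynomial.coeff_C]⟩⟩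

theorem linear (Q : Set (V → ℂ)) (l : V →ₗ[ℂ] ℂ) : QuadraticPartIn Q fun x => l x :=
  ⟨0, l, 0, zero_mem _, fun x => ⟨Polynomial.C (l x) * Polynomial.X,
    fun t => by simp [mul_comm t], by simp, by simp, by simp⟩⟩

theorem add (hf : QuadraticPartIn Q f) (hg : QuadraticPartIn Q g) :
    QuadraticPartIn Q fun x => f x + g x := by
  obtain ⟨c, l, q, hq, hp⟩ := hf
  obtain ⟨c', l', q', hq', hp'⟩ := hg
  refine ⟨c + c', l + l', q + q', add_mem hq hq', fun x => ?_⟩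
  obtain ⟨p, h, h0, h1, h2⟩ := hp x
  obtain ⟨p', h', h0', h1', h2'⟩ := hp' x
  exact ⟨p + p', by simp [h, h', h0, h0', h1, h1', h2, h2']⟩

theorem const_mul (a : ℂ) (hf : QuadraticPartIn Q f) : QuadraticPartIn Q fun x => a * f x := by
  obtain ⟨c, l, q, hq, hp⟩ := hf
  refine ⟨a * c, a • l, a • q, Submodule.smul_mem _ _ hq, fun x => ?_⟩
  obtain ⟨p, h, h0, h1, h2⟩ := hp x
  exact ⟨Polynomial.C a * p, by simp [h, h0, h1, h2]⟩

/-- On each line through the origin `g` is a complex polynomial without roots, hence constant, and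
all these lines share the value `c` at the origin. Thus every permitted division is a division by a
scalar. -/
theorem eq_const_of_ne_zero (hg : QuadraticPartIn Q g) (hne : ∀ x, g x ≠ 0) :
    ∃ c, g = fun _ => c := by
  obtain ⟨c, l, q, hq, hp⟩ := hg
  refine ⟨c, funext fun x => ?_⟩
  obtain ⟨p, h, h0, -, -⟩ := hp x
  have hdeg : p.degree = 0 := by
    by_contra hd
    obtain ⟨t, ht⟩ := IsAlgClosed.exists_root p hd
    exact hne (t • x) ((h t).trans ht)
  have h1 := h 1
  rw [Polynomial.eq_C_of_degree_eq_zero hdeg, one_smul, Polynomial.eval_C, h0] at h1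
  exact h1

/-- The quadratic part of a product is $cq'+c'q+ll'$; only the product of the two linear parts is
new. -/
theorem mul (hf : QuadraticPartIn Q f) (hg : QuadraticPartIn Q g) :
    ∃ l m : V →ₗ[ℂ] ℂ, QuadraticPartIn (insert (fun x => l x * m x) Q) fun x => f x * g x := by
  obtain ⟨c, l, q, hq, hp⟩ := hf
  obtain ⟨c', l', q', hq', hp'⟩ := hg
  have hsub := Submodule.span_mono (R := ℂ) (Set.subset_insert (fun x => l x * l' x) Q)
  refine ⟨l, l', c * c', c • l' + c' • l, c • q' + c' • q + fun x => l x * l' x,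
    add_mem (add_mem (Submodule.smul_mem _ _ (hsub hq')) (Submodule.smul_mem _ _ (hsub hq)))
      (Submodule.subset_span (Set.mem_insert _ _)), fun x => ?_⟩
  obtain ⟨p, h, h0, h1, h2⟩ := hp x
  obtain ⟨p', h', h0', h1', h2'⟩ := hp' x
  refine ⟨p * p', fun t => by simp [h, h'], by simp [Polynomial.mul_coeff_zero, h0, h0'], ?_, ?_⟩
  · simp [Polynomial.mul_coeff_one, h0, h0', h1, h1']; ring
  · rw [Polynomial.coeff_mul]
    simp [Finset.Nat.antidiagonal_succ, h0, h0', h1, h1', h2, h2']; ring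

theorem sub (hf : QuadraticPartIn Q f) (hg : QuadraticPartIn Q g) :
    QuadraticPartIn Q fun x => f x - g x := by
  simpa [sub_eq_add_neg] using hf.add (hg.const_mul (-1))

theorem div (hf : QuadraticPartIn Q f) (hg : QuadraticPartIn Q g) (hne : ∀ x, g x ≠ 0) :
    QuadraticPartIn Q fun x => f x / g x := by
  obtain ⟨c, rfl⟩ := hg.eq_const_of_ne_zero hne
  simpa [div_eq_inv_mul] using hf.const_mul c⁻¹

/-- A function that is homogeneous of degree two is its own quadratic part. -/
theorem mem_span (hf : QuadraticPartIn Q f) (h2 : ∀ (t : ℂ) x, f (t • x) = t ^ 2 * f x) :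
    f ∈ Submodule.span ℂ Q := by
  obtain ⟨c, l, q, hq, hp⟩ := hf
  have : f = q := by
    funext x
    obtain ⟨p, h, -, -, hpq⟩ := hp x
    have : p = Polynomial.C (f x) * Polynomial.X ^ 2 := by
      refine Polynomial.funext fun t => ?_
      rw [← h, h2, Polynomial.eval_mul, Polynomial.eval_C, Polynomial.eval_pow,
        Polynomial.eval_X, mul_comm]
    rw [← hpq, this]
    simp
  rwa [this]

end QuadraticPartIn

theorem ArithComputation.exists_quadratic {V : Type} [AddCommGroup V] [Module ℂ V]
    {A S : Set (V → ℂ)} {s : ℕ} (hS : ArithComputation A s S)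
    (hA : ∀ f ∈ A, QuadraticPartIn ∅ f) :
    ∃ l m : Fin s → V →ₗ[ℂ] ℂ,
      ∀ f ∈ S, QuadraticPartIn (Set.range fun k x => l k x * m k x) f := by
  have key : ∃ Q : List ((V →ₗ[ℂ] ℂ) × (V →ₗ[ℂ] ℂ)), Q.length = s ∧
      ∀ f ∈ S, QuadraticPartIn {g | ∃ a ∈ Q, g = fun x => a.1 x * a.2 x} f := by
    have hins : ∀ (Q : List ((V →ₗ[ℂ] ℂ) × (V →ₗ[ℂ] ℂ))) (l m : V →ₗ[ℂ] ℂ),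
        {g | ∃ a ∈ (l, m) :: Q, g = fun x => a.1 x * a.2 x} =
          insert (fun x => l x * m x) {g | ∃ a ∈ Q, g = fun x => a.1 x * a.2 x} := by
      intro Q l m
      ext g
      simp
    induction hS with
    | start => exact ⟨[], rfl, fun f hf => (hA f hf).mono (Set.empty_subset _)⟩
    | add hS hf hg ih =>
      obtain ⟨Q, hQ, h⟩ := ih
      -- Only multiplications need a new product; the zero pair keeps the length of the list equal
      -- to the number of operations.
      refine ⟨(0, 0) :: Q, by simp [hQ], ?_⟩
      rw [hins]
      rintro _ (rfl | hf')
      · exact ((h _ hf).add (h _ hg)).mono (Set.subset_insert _ _)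
      · exact (h _ hf').mono (Set.subset_insert _ _)
    | sub hS hf hg ih =>
      obtain ⟨Q, hQ, h⟩ := ih
      refine ⟨(0, 0) :: Q, by simp [hQ], ?_⟩
      rw [hins]
      rintro _ (rfl | hf')
      · exact ((h _ hf).sub (h _ hg)).mono (Set.subset_insert _ _)
      · exact (h _ hf').mono (Set.subset_insert _ _)
    | mul hS hf hg ih =>
      obtain ⟨Q, hQ, h⟩ := ih
      obtain ⟨l, m, hlm⟩ := (h _ hf).mul (h _ hg)
      refine ⟨(l, m) :: Q, by simp [hQ], ?_⟩
      rw [hins]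
      rintro _ (rfl | hf')
      · exact hlm
      · exact (h _ hf').mono (Set.subset_insert _ _)
    | div hS hf hg hne ih =>
      obtain ⟨Q, hQ, h⟩ := ih
      refine ⟨(0, 0) :: Q, by simp [hQ], ?_⟩
      rw [hins]
      rintro _ (rfl | hf')
      · exact ((h _ hf).div (h _ hg) hne).mono (Set.subset_insert _ _)
      · exact (h _ hf').mono (Set.subset_insert _ _)
  obtain ⟨Q, rfl, h⟩ := key
  refine ⟨fun k => (Q.get k).1, fun k => (Q.get k).2, fun f hf => (h f hf).mono ?_⟩
  rintro _ ⟨a, ha, rfl⟩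
  obtain ⟨k, rfl⟩ := List.get_of_mem ha
  exact ⟨k, rfl⟩

/-- Entries of $AB$ are homogeneous quadratic, so they lie in the span of the $s$ products $l_k m_k$
of linear forms in $(A,B)$. Only the mixed part of each product matters, namely
$l_k(A,0)m_k(0,B)+m_k(A,0)l_k(0,B)$: two bilinear products, whence the factor 2. -/
theorem CanMultiplyIn.matMulRankLE {n s : ℕ} (h : CanMultiplyIn n s) :
    MatMulRankLE (Fin n) (2 * s) := by
  obtain ⟨S, hS, hout⟩ := h
  obtain ⟨l, m, hq⟩ := hS.exists_quadratic (by
    rintro f (⟨i, j, rfl⟩ | ⟨i, j, rfl⟩ | ⟨c, rfl⟩)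
    · exact QuadraticPartIn.linear _
        ((Matrix.entryLinearMap ℂ ℂ i j).comp
          (LinearMap.fst ℂ (Matrix (Fin n) (Fin n) ℂ) (Matrix (Fin n) (Fin n) ℂ)))
    · exact QuadraticPartIn.linear _
        ((Matrix.entryLinearMap ℂ ℂ i j).comp
          (LinearMap.snd ℂ (Matrix (Fin n) (Fin n) ℂ) (Matrix (Fin n) (Fin n) ℂ)))
    · exact QuadraticPartIn.const _ _)
  have hspan : ∀ i j, ∃ c : Fin s → ℂ, ∀ A B : Matrix (Fin n) (Fin n) ℂ,
      (A * B) i j = ∑ k, c k * (l k (A, B) * m k (A, B)) := by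
    intro i j
    have := (hq _ (hout i j)).mem_span (fun t x => by
      simp [pow_two, mul_assoc])
    obtain ⟨c, hc⟩ := (Submodule.mem_span_range_iff_exists_fun ℂ).1 this
    refine ⟨c, fun A B => ?_⟩
    have := congrFun hc (A, B)
    simp only [Finset.sum_apply, Pi.smul_apply, smul_eq_mul] at this
    exact this.symm
  choose c hc using hspan
  have := BilinRankLE.of_fintype (φ := fun A B : Matrix (Fin n) (Fin n) ℂ => A * B)
    (ι := Bool × Fin s)
    (fun k => bif k.1 then l k.2 ∘ₗ LinearMap.inl ℂ _ _ else m k.2 ∘ₗ LinearMap.inl ℂ _ _)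
    (fun k => bif k.1 then m k.2 ∘ₗ LinearMap.inr ℂ _ _ else l k.2 ∘ₗ LinearMap.inr ℂ _ _)
    (fun k => Matrix.of fun i j => c i j k.2) (fun A B => by
      ext i j
      have h1 := hc i j A B
      have h2 := hc i j A 0
      have h3 := hc i j 0 B
      have hl : ∀ k, l k (A, B) = l k (A, 0) + l k (0, B) := fun k => by
        rw [← map_add]; simp
      have hm : ∀ k, m k (A, B) = m k (A, 0) + m k (0, B) := fun k => by
        rw [← map_add]; simp
      simp only [hl, hm] at h1
      rw [mul_zero, Matrix.zero_apply] at h2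
      rw [zero_mul, Matrix.zero_apply] at h3
      rw [Fintype.sum_prod_type, Fintype.sum_bool]
      simp only [Matrix.add_apply, Matrix.sum_apply, Matrix.smul_apply, cond_true, cond_false,
        LinearMap.comp_apply, LinearMap.inl_apply, LinearMap.inr_apply, Matrix.of_apply,
        smul_eq_mul]
      rw [← Finset.sum_add_distrib]
      -- The unmixed sums vanish, being entries of $A\cdot0$ and $0\cdot B$.
      calc (A * B) i j = (A * B) i j - ∑ k, c i j k * (l k (A, 0) * m k (A, 0)) -
            ∑ k, c i j k * (l k (0, B) * m k (0, B)) := by rw [← h2, ← h3]; ring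
        _ = _ := by
          rw [h1, ← Finset.sum_sub_distrib, ← Finset.sum_sub_distrib]
          exact Finset.sum_congr rfl fun k _ => by ring)
  simpa [MatMulRankLE] using this

/-! ### From bilinear rank to programs -/

/-- Once the functions in `S` are available, those in `T` can be computed by `s` further field
operations. -/
def ComputableFrom {X : Type} (S T : Set (X → ℂ)) (s : ℕ) : Prop :=
  ∀ (A : Set (X → ℂ)) (s₀ : ℕ) (S₀ : Set (X → ℂ)), ArithComputation A s₀ S₀ → S ⊆ S₀ →
    ∃ S₁, S₀ ⊆ S₁ ∧ T ⊆ S₁ ∧ ArithComputation A (s₀ + s) S₁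

namespace ComputableFrom

variable {X : Type} {S T U : Set (X → ℂ)} {s t : ℕ}

theorem of_subset (h : T ⊆ S) : ComputableFrom S T 0 :=
  fun _ _ S₀ h₀ hS => ⟨S₀, subset_rfl, h.trans hS, h₀⟩

theorem mono {S' T' : Set (X → ℂ)} (h : ComputableFrom S T s) (hS : S ⊆ S') (hT : T' ⊆ T) :
    ComputableFrom S' T' s := fun A s₀ S₀ h₀ h₁ => by
  obtain ⟨S₁, h2, h3, h4⟩ := h A s₀ S₀ h₀ (hS.trans h₁)
  exact ⟨S₁, h2, hT.trans h3, h4⟩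

theorem trans (h : ComputableFrom S T s) (h' : ComputableFrom (S ∪ T) U t) :
    ComputableFrom S (T ∪ U) (s + t) := fun A s₀ S₀ h₀ h₁ => by
  obtain ⟨S₁, h2, h3, h4⟩ := h A s₀ S₀ h₀ h₁
  obtain ⟨S₂, h5, h6, h7⟩ := h' A _ S₁ h4 (Set.union_subset (h₁.trans h2) h3)
  exact ⟨S₂, h2.trans h5, Set.union_subset (h3.trans h5) h6, by rwa [← add_assoc]⟩

theorem union (h : ComputableFrom S T s) (h' : ComputableFrom S U t) :
    ComputableFrom S (T ∪ U) (s + t) :=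
  h.trans (h'.mono Set.subset_union_left subset_rfl)

theorem mul {f g : X → ℂ} (hf : f ∈ S) (hg : g ∈ S) :
    ComputableFrom S {fun x => f x * g x} 1 := fun _ _ _ h₀ h₁ =>
  ⟨_, Set.subset_insert _ _, by simp, .mul h₀ (h₁ hf) (h₁ hg)⟩

theorem add {f g : X → ℂ} (hf : f ∈ S) (hg : g ∈ S) :
    ComputableFrom S {fun x => f x + g x} 1 := fun _ _ _ h₀ h₁ =>
  ⟨_, Set.subset_insert _ _, by simp, .add h₀ (h₁ hf) (h₁ hg)⟩

theorem biUnion {ι : Type*} (J : Finset ι) {T : ι → Set (X → ℂ)}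
    (h : ∀ i ∈ J, ComputableFrom S (T i) s) : ComputableFrom S (⋃ i ∈ J, T i) (J.card * s) := by
  classical
  induction J using Finset.induction_on with
  | empty => simpa using of_subset (Set.empty_subset _)
  | insert a J ha ih =>
    rw [Finset.card_insert_of_notMem ha, add_mul, one_mul, Finset.set_biUnion_insert,
      Set.union_comm]
    exact (ih fun i hi => h i (Finset.mem_insert_of_mem hi)).union
      (h a (Finset.mem_insert_self _ _))

theorem iUnion {ι : Type*} [Fintype ι] {T : ι → Set (X → ℂ)}
    (h : ∀ i, ComputableFrom S (T i) s) : ComputableFrom S (⋃ i, T i) (Fintype.card ι * s) := by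
  simpa using biUnion Finset.univ fun i _ => h i

theorem range {ι : Type*} [Fintype ι] {f : ι → X → ℂ}
    (h : ∀ i, ComputableFrom S {f i} s) :
    ComputableFrom S (Set.range f) (Fintype.card ι * s) := by
  simpa using iUnion h

theorem linearCombination_finset {ι : Type*} (J : Finset ι) (c : ι → ℂ) {f : ι → X → ℂ}
    (hc : ∀ c : ℂ, (fun _ => c) ∈ S) (hf : ∀ i, f i ∈ S) :
    ComputableFrom S {fun x => ∑ i ∈ J, c i * f i x} (J.card * 2) := by
  classical
  induction J using Finset.induction_on with
  | empty => simpa using of_subset (Set.singleton_subset_iff.2 (hc 0))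
  | insert a J ha ih =>
    rw [Finset.card_insert_of_notMem ha, add_mul, one_mul]
    have h1 := ih.union (mul (hc (c a)) (hf a))
    have h2 := h1.trans (add (f := fun x => c a * f a x) (g := fun x => ∑ i ∈ J, c i * f i x)
      (by simp) (by simp))
    refine (h2.mono subset_rfl ?_)
    simp [Finset.sum_insert ha]

theorem linearCombination {ι : Type*} [Fintype ι] (c : ι → ℂ) {f : ι → X → ℂ}
    (hc : ∀ c : ℂ, (fun _ => c) ∈ S) (hf : ∀ i, f i ∈ S) :
    ComputableFrom S {fun x => ∑ i, c i * f i x} (Fintype.card ι * 2) :=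
  linearCombination_finset Finset.univ c hc hf

end ComputableFrom

/-- Any two matrices with rows and columns indexed by `ι` whose entries are available functions
can be multiplied by `s` field operations. -/
def MatMulComputable (ι : Type*) [Fintype ι] (s : ℕ) : Prop :=
  ∀ (X : Type) (S : Set (X → ℂ)) (a b : ι × ι → X → ℂ), (∀ c : ℂ, (fun _ => c) ∈ S) →
    (∀ p, a p ∈ S) → (∀ p, b p ∈ S) →
    ComputableFrom S (Set.range fun (p : ι × ι) x => ∑ k, a (p.1, k) x * b (k, p.2) x) s

namespace MatMulComputable

theorem of_unique (ι : Type*) [Unique ι] : MatMulComputable ι 1 := by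
  intro X S a b _ ha hb
  refine (ComputableFrom.mul (ha default) (hb default)).mono subset_rfl ?_
  rintro _ ⟨p, rfl⟩
  rw [Subsingleton.elim p default]
  simp only [Finset.univ_unique, Finset.sum_singleton]
  rfl

theorem of_embedding {ι κ : Type*} [Fintype ι] [Fintype κ] {s : ℕ} (h : MatMulComputable κ s)
    (e : ι ↪ κ) : MatMulComputable ι s := by
  classical
  intro X S a b hc ha hb
  have ext : ∀ f : ι × ι → X → ℂ, (∀ p, f p ∈ S) → ∃ f' : κ × κ → X → ℂ, (∀ p, f' p ∈ S) ∧
      (∀ i j, f' (e i, e j) = f (i, j)) ∧ ∀ i k, k ∉ Set.range e → f' (i, k) = 0 := by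
    intro f hf
    refine ⟨fun p => if h : ∃ q : ι × ι, (e q.1, e q.2) = p then f h.choose else 0, ?_, ?_, ?_⟩
    · intro p
      dsimp only
      split_ifs
      exacts [hf _, hc 0]
    · intro i j
      have hq : ∃ q : ι × ι, (e q.1, e q.2) = (e i, e j) := ⟨(i, j), rfl⟩
      dsimp only
      rw [dif_pos hq]
      have := hq.choose_spec
      rw [Prod.mk.injEq, e.apply_eq_iff_eq, e.apply_eq_iff_eq] at this
      exact congrArg f (Prod.ext this.1 this.2)
    · intro i k hk
      refine dif_neg ?_
      rintro ⟨q, hq⟩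
      exact hk ⟨q.2, congrArg Prod.snd hq⟩
  obtain ⟨a', ha', haa, ha0⟩ := ext a ha
  obtain ⟨b', hb', hbb, -⟩ := ext b hb
  refine (h X S a' b' hc ha' hb').mono subset_rfl ?_
  rintro _ ⟨p, rfl⟩
  refine ⟨(e p.1, e p.2), funext fun x => ?_⟩
  dsimp only
  -- Vanishing of the padded left factor alone removes the extra terms.
  rw [← Finset.sum_subset (Finset.subset_univ (Finset.univ.map e))]
  · rw [Finset.sum_map]
    simp only [haa, hbb]
  · intro k _ hk
    rw [ha0 _ _ (by simpa using hk)]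
    simp

theorem canMultiplyIn {n s : ℕ} (h : MatMulComputable (Fin n) s) : CanMultiplyIn n s := by
  obtain ⟨S, -, h1, h2⟩ := h (MatrixPair n) (matMulInputs n) (fun q p => p.1 q.1 q.2)
    (fun q p => p.2 q.1 q.2) (fun c => Or.inr (Or.inr ⟨c, rfl⟩))
    (fun q => Or.inl ⟨q.1, q.2, rfl⟩) (fun q => Or.inr (Or.inl ⟨q.1, q.2, rfl⟩)) _ _ _ .start
    subset_rfl
  refine ⟨S, by simpa using h2, fun i j => h1 ⟨(i, j), ?_⟩⟩
  funext p
  simp [Matrix.mul_apply]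

end MatMulComputable

theorem MatMulRankLE.exists_coeff {ι : Type*} [Fintype ι] {r : ℕ} (h : MatMulRankLE ι r) :
    ∃ u v w : Fin r → ι × ι → ℂ, ∀ (A B : ι × ι → ℂ) (i j : ι),
      ∑ k, A (i, k) * B (k, j) =
        ∑ k, w k (i, j) * ((∑ p, u k p * A p) * ∑ p, v k p * B p) := by
  classical
  obtain ⟨u, v, w, h⟩ := h
  have hlin : ∀ (l : Matrix ι ι ℂ →ₗ[ℂ] ℂ) (A : ι × ι → ℂ),
      l (Matrix.of fun i j => A (i, j)) = ∑ p : ι × ι, l (Matrix.single p.1 p.2 1) * A p := by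
    intro l A
    rw [Matrix.matrix_eq_sum_single (Matrix.of fun i j => A (i, j)), Fintype.sum_prod_type]
    simp only [map_sum]
    refine Finset.sum_congr rfl fun i _ => Finset.sum_congr rfl fun j _ => ?_
    rw [mul_comm, ← smul_eq_mul, ← map_smul, Matrix.smul_single]
    simp
  refine ⟨fun k p => u k (Matrix.single p.1 p.2 1), fun k p => v k (Matrix.single p.1 p.2 1),
    fun k p => w k p.1 p.2, fun A B i j => ?_⟩
  have := congrFun (congrFun (h (Matrix.of fun i j => A (i, j)) (Matrix.of fun i j => B (i, j)))
    i) j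
  simp only [Matrix.mul_apply, Matrix.sum_apply, Matrix.smul_apply, hlin, smul_eq_mul,
    Matrix.of_apply] at this
  rw [this]
  exact Finset.sum_congr rfl fun k _ => mul_comm _ _

/-- One level of the recursive block algorithm. -/
theorem MatMulRankLE.matMulComputable_prod {ι κ : Type*} [Fintype ι] [Fintype κ] {r t : ℕ}
    (h : MatMulRankLE ι r) (hκ : MatMulComputable κ t) :
    MatMulComputable (ι × κ)
      (r * t + 6 * r * Fintype.card ι ^ 2 * Fintype.card κ ^ 2) := by
  obtain ⟨u, v, w, h⟩ := h.exists_coeff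
  intro X S a b hc ha hb
  let a' : Fin r → κ × κ → X → ℂ := fun k q x =>
    ∑ p : ι × ι, u k p * a ((p.1, q.1), (p.2, q.2)) x
  let b' : Fin r → κ × κ → X → ℂ := fun k q x =>
    ∑ p : ι × ι, v k p * b ((p.1, q.1), (p.2, q.2)) x
  let d : Fin r → κ × κ → X → ℂ := fun k q x => ∑ z, a' k (q.1, z) x * b' k (z, q.2) x
  have h1 : ComputableFrom S (Set.range fun q : Fin r × (κ × κ) => a' q.1 q.2) _ :=
    ComputableFrom.range fun q => ComputableFrom.linearCombination (u q.1) hc fun p => ha _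
  have h2 : ComputableFrom S (Set.range fun q : Fin r × (κ × κ) => b' q.1 q.2) _ :=
    ComputableFrom.range fun q => ComputableFrom.linearCombination (v q.1) hc fun p => hb _
  have h3 : ComputableFrom (S ∪ ((Set.range fun q : Fin r × (κ × κ) => a' q.1 q.2) ∪
      Set.range fun q : Fin r × (κ × κ) => b' q.1 q.2)) (⋃ k, Set.range (d k)) _ :=
    ComputableFrom.iUnion fun k => hκ X _ (a' k) (b' k) (fun c => Or.inl (hc c))
      (fun q => Or.inr (Or.inl ⟨(k, q), rfl⟩)) (fun q => Or.inr (Or.inr ⟨(k, q), rfl⟩))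
  have h4 := (h1.union h2).trans h3
  have h5 := h4.trans (U := Set.range fun (q : (ι × ι) × (κ × κ)) x =>
      ∑ k, w k q.1 * d k q.2 x)
    (ComputableFrom.range fun q => ComputableFrom.linearCombination (fun k => w k q.1)
      (fun c => Or.inl (hc c)) fun k => Or.inr (Or.inr (Set.mem_iUnion.2 ⟨k, q.2, rfl⟩)))
  -- The 6 comes from three families of linear combinations (left factors, right factors, outputs),
  -- each costing two operations per term.
  have hcount : r * t + 6 * r * Fintype.card ι ^ 2 * Fintype.card κ ^ 2 =
      Fintype.card (Fin r × (κ × κ)) * (Fintype.card (ι × ι) * 2) +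
        Fintype.card (Fin r × (κ × κ)) * (Fintype.card (ι × ι) * 2) +
        Fintype.card (Fin r) * t +
        Fintype.card ((ι × ι) × (κ × κ)) * (Fintype.card (Fin r) * 2) := by
    simp only [Fintype.card_prod, Fintype.card_fin]
    ring
  rw [hcount]
  refine h5.mono subset_rfl (Set.Subset.trans ?_ Set.subset_union_right)
  rintro _ ⟨⟨⟨i, p⟩, ⟨j, q⟩⟩, rfl⟩
  refine ⟨((i, j), (p, q)), funext fun x => ?_⟩
  -- The scalar identity is applied for each inner index `z`; summation over `z` turns its scalar
  -- products into products of blocks.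
  have h6 := fun z => h (fun e => a ((e.1, p), (e.2, z)) x) (fun e => b ((e.1, z), (e.2, q)) x) i j
  dsimp only at h6 ⊢
  rw [Fintype.sum_prod_type, Finset.sum_comm]
  simp only [h6]
  rw [Finset.sum_comm]
  simp only [d, a', b', Finset.mul_sum]

theorem MatMulRankLE.exists_matMulComputable {N r : ℕ} (h : MatMulRankLE (Fin N) r)
    (hr : N ^ 2 + 1 ≤ r) (l : ℕ) :
    ∃ s, s ≤ (1 + 6 * r * N ^ 2) * r ^ l ∧ MatMulComputable (Fin (N ^ l)) s := by
  -- The extra summand makes the induction close: one level multiplies it by $N^2$ and adds one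
  -- further copy, and $N^2+1\le r$ absorbs both.
  suffices ∃ s, s + 6 * r * N ^ 2 * (N ^ l) ^ 2 ≤ (1 + 6 * r * N ^ 2) * r ^ l ∧
      MatMulComputable (Fin (N ^ l)) s by
    obtain ⟨s, h1, h2⟩ := this
    exact ⟨s, by omega, h2⟩
  induction l with
  | zero =>
    refine ⟨1, ?_, (MatMulComputable.of_unique Unit).of_embedding
      (Fintype.equivOfCardEq (by simp)).toEmbedding⟩
    simp
  | succ l ih =>
    obtain ⟨s, h1, h2⟩ := ih
    refine ⟨_, ?_, (h.matMulComputable_prod h2).of_embedding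
      (Fintype.equivOfCardEq (by simp [pow_succ, mul_comm])).toEmbedding⟩
    simp only [Fintype.card_fin]
    calc r * s + 6 * r * N ^ 2 * (N ^ l) ^ 2 + 6 * r * N ^ 2 * (N ^ (l + 1)) ^ 2
        = r * s + 6 * r * N ^ 2 * (N ^ l) ^ 2 * (N ^ 2 + 1) := by ring
      _ ≤ r * s + 6 * r * N ^ 2 * (N ^ l) ^ 2 * r := by gcongr
      _ = r * (s + 6 * r * N ^ 2 * (N ^ l) ^ 2) := by ring
      _ ≤ r * ((1 + 6 * r * N ^ 2) * r ^ l) := by gcongr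
      _ = _ := by ring

theorem MatMulRankLE.logb_mem_matMulExponents {N r : ℕ} (hN : 2 ≤ N)
    (h : MatMulRankLE (Fin N) r) (hr : N ^ 2 + 1 ≤ r) :
    Real.logb N r ∈ matMulExponents := by
  have hr1 : (1 : ℝ) ≤ r := by exact_mod_cast (by omega : 1 ≤ r)
  have hN1 : (1 : ℝ) < N := by exact_mod_cast (by omega : 1 < N)
  have hlog : 0 ≤ Real.logb N r := Real.logb_nonneg hN1 hr1
  refine ⟨(1 + 6 * r * N ^ 2) * r, fun n hn => ?_⟩
  obtain ⟨s, hs, hM⟩ := h.exists_matMulComputable hr (Nat.clog N n)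
  have hle : n ≤ N ^ Nat.clog N n := Nat.le_pow_clog (by omega) n
  refine ⟨s, ?_, (hM.of_embedding (Fin.castLEEmb hle)).canMultiplyIn⟩
  have hs' : (s : ℝ) ≤ (1 + 6 * r * N ^ 2) * r ^ Nat.clog N n := by exact_mod_cast hs
  refine hs'.trans ?_
  rw [mul_assoc (_ + _)]
  refine mul_le_mul_of_nonneg_left ?_ (by positivity)
  -- Rounding the size up to a power of `N` loses at most a factor `N`, which costs a factor `r`
  -- after raising to $\log_N r$.
  have hlt : ((N : ℝ)) ^ Nat.clog N n ≤ N * n := by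
    rcases Nat.eq_zero_or_pos (Nat.clog N n) with h0 | h0
    · rw [h0, pow_zero]
      have : (1 : ℝ) ≤ n := by exact_mod_cast hn
      nlinarith
    · obtain ⟨m, hm⟩ := Nat.exists_eq_succ_of_ne_zero h0.ne'
      have : N ^ m < n := by
        by_contra! hcon
        have := Nat.clog_le_of_le_pow hcon
        omega
      rw [hm, pow_succ, mul_comm]
      gcongr
      exact_mod_cast this.le
  calc (r : ℝ) ^ Nat.clog N n = ((N : ℝ) ^ Real.logb N r) ^ Nat.clog N n := by
        rw [Real.rpow_logb (by linarith) hN1.ne' (by linarith)]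
    _ = ((N : ℝ) ^ Nat.clog N n) ^ Real.logb N r := by
        rw [← Real.rpow_natCast, ← Real.rpow_mul (by linarith), mul_comm,
          Real.rpow_mul (by linarith), Real.rpow_natCast]
    _ ≤ (N * n : ℝ) ^ Real.logb N r := by gcongr
    _ = r * (n : ℝ) ^ Real.logb N r := by
        rw [Real.mul_rpow (by linarith) (by positivity),
          Real.rpow_logb (by linarith) hN1.ne' (by linarith)]

/-! ### Matrix representations that detect the identity -/

/-- Matrix representations `D i` of `G`, together with matrices `L i` of coefficients, such that
the corresponding combination of the matrix entries is the indicator function of `1`. -/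
structure DetectingReps (G : Type*) [Group G] {ι : Type*} [Fintype ι] (κ : ι → Type*)
    [∀ i, Fintype (κ i)] where
  toFun : ∀ i, G → Matrix (κ i) (κ i) ℂ
  map_mul : ∀ i g h, toFun i (g * h) = toFun i g * toFun i h
  coeff : ∀ i, κ i → κ i → ℂ
  sum_coeff_one : ∑ i, ∑ a, ∑ b, coeff i a b * toFun i 1 a b = 1
  sum_coeff_of_ne : ∀ g, g ≠ 1 → ∑ i, ∑ a, ∑ b, coeff i a b * toFun i g a b = 0

/-- Tensor products of detecting representations detect the identity of a product group. -/
def DetectingReps.pi {G : Type*} [Group G] {ι : Type*} [Fintype ι] {κ : ι → Type*}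
    [∀ i, Fintype (κ i)] (D : DetectingReps G κ) (J : Type*) [Fintype J] [DecidableEq J] :
    DetectingReps (J → G) (fun I : J → ι => ∀ j, κ (I j)) :=
  have key : ∀ g : J → G, ∑ I : J → ι, ∑ a : ∀ j, κ (I j), ∑ b : ∀ j, κ (I j),
      (∏ j, D.coeff (I j) (a j) (b j)) * ∏ j, D.toFun (I j) (g j) (a j) (b j) =
      ∏ j, ∑ i, ∑ a, ∑ b, D.coeff i a b * D.toFun i (g j) a b := by
    intro g
    simp only [Finset.prod_univ_sum, Fintype.piFinset_univ, Finset.prod_mul_distrib]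
  { toFun := fun I g => Matrix.of fun a b => ∏ j, D.toFun (I j) (g j) (a j) (b j)
    map_mul := by
      intro I g h
      ext a b
      simp only [Matrix.mul_apply, Matrix.of_apply, Pi.mul_apply, D.map_mul, Finset.prod_univ_sum,
        Fintype.piFinset_univ, Finset.prod_mul_distrib]
    coeff := fun I a b => ∏ j, D.coeff (I j) (a j) (b j)
    sum_coeff_one := by
      refine (key 1).trans (Finset.prod_eq_one fun j _ => ?_)
      exact D.sum_coeff_one
    sum_coeff_of_ne := by
      intro g hg
      obtain ⟨j, hj⟩ := Function.ne_iff.1 hg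
      exact (key g).trans (Finset.prod_eq_zero (Finset.mem_univ j) (D.sum_coeff_of_ne _ hj)) }

/-- A triple with the triple product property embeds matrix multiplication into the group
algebra, hence into a sum of matrix multiplications. -/
theorem TripleProductProperty.bilinRankLE {G : Type*} [Group G] {S₁ S₂ S₃ : Finset G}
    (h : TripleProductProperty S₁ S₂ S₃) {ι : Type*} [Fintype ι] {κ : ι → Type*}
    [∀ i, Fintype (κ i)] (D : DetectingReps G κ) {r : ι → ℕ} (hr : ∀ i, MatMulRankLE (κ i) (r i)) :
    BilinRankLE (fun (A : Matrix S₁ S₂ ℂ) (B : Matrix S₂ S₃ ℂ) => A * B) (∑ i, r i) := by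
  classical
  let F : ∀ i, Matrix S₁ S₂ ℂ →ₗ[ℂ] Matrix (κ i) (κ i) ℂ := fun i =>
    ∑ s : S₁, ∑ t : S₂, (Matrix.entryLinearMap ℂ ℂ s t).smulRight
      (D.toFun i ((s : G)⁻¹ * t))
  let H : ∀ i, Matrix S₂ S₃ ℂ →ₗ[ℂ] Matrix (κ i) (κ i) ℂ := fun i =>
    ∑ t : S₂, ∑ u : S₃, (Matrix.entryLinearMap ℂ ℂ t u).smulRight
      (D.toFun i ((t : G)⁻¹ * u))
  let K : ∀ i, Matrix (κ i) (κ i) ℂ →ₗ[ℂ] Matrix S₁ S₃ ℂ := fun i =>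
    { toFun := fun Z => Matrix.of fun s u => ∑ a, ∑ b, D.coeff i a b *
        (D.toFun i (s : G) * Z * D.toFun i (u : G)⁻¹) a b
      map_add' := fun Y Z => by
        ext s u
        simp [Matrix.add_mul, mul_add, Finset.sum_add_distrib]
      map_smul' := fun c Z => by
        ext s u
        simp [Finset.mul_sum, mul_left_comm] }
  have hF : ∀ i A, F i A = ∑ s : S₁, ∑ t : S₂, A s t • D.toFun i ((s : G)⁻¹ * t) := by
    intro i A; simp [F]
  have hH : ∀ i B, H i B = ∑ t : S₂, ∑ u : S₃, B t u • D.toFun i ((t : G)⁻¹ * u) := by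
    intro i B; simp [H]
  -- The group element is $(ss'^{-1})(tt'^{-1})(u'u^{-1})$, which is 1 only if all three quotients
  -- are. Detecting the identity therefore extracts exactly the terms of $(AB)_{su}$.
  have hdet : ∀ (s s' : S₁) (t t' : S₂) (u' u : S₃),
      ∑ i, ∑ a, ∑ b, D.coeff i a b *
        D.toFun i (s * ((s' : G)⁻¹ * t * ((t' : G)⁻¹ * u')) * (u : G)⁻¹) a b =
      if s' = s ∧ t' = t ∧ u' = u then 1 else 0 := by
    intro s s' t t' u' u
    split_ifs with hc
    · obtain ⟨rfl, rfl, rfl⟩ := hc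
      have : (s' * ((s' : G)⁻¹ * t' * ((t' : G)⁻¹ * u')) * (u' : G)⁻¹) = 1 := by group
      rw [this]
      exact D.sum_coeff_one
    · refine D.sum_coeff_of_ne _ fun h1 => hc ?_
      obtain ⟨h2, h3, h4⟩ := h (s * (s' : G)⁻¹) ⟨s, s.2, s', s'.2, rfl⟩ (t * (t' : G)⁻¹)
        ⟨t, t.2, t', t'.2, rfl⟩ (u' * (u : G)⁻¹) ⟨u', u'.2, u, u.2, rfl⟩
        (by rw [← h1]; group)
      exact ⟨(Subtype.ext (mul_inv_eq_one.1 h2)).symm, (Subtype.ext (mul_inv_eq_one.1 h3)).symm,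
        Subtype.ext (mul_inv_eq_one.1 h4)⟩
  convert BilinRankLE.sum fun i => (hr i).comp (F i) (H i) (K i) using 3 with A B
  ext s u
  rw [Matrix.sum_apply]
  have hK : ∀ i, K i (F i A * H i B) s u = ∑ s' : S₁, ∑ t : S₂, ∑ t' : S₂, ∑ u' : S₃,
      A s' t * B t' u' * ∑ a, ∑ b, D.coeff i a b *
        D.toFun i (s * ((s' : G)⁻¹ * t * ((t' : G)⁻¹ * u')) * (u : G)⁻¹) a b := by
    intro i
    have hprod : F i A * H i B = ∑ s' : S₁, ∑ t : S₂, ∑ t' : S₂, ∑ u' : S₃,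
        (A s' t * B t' u') • D.toFun i ((s' : G)⁻¹ * t * ((t' : G)⁻¹ * u')) := by
      simp only [hF, Matrix.sum_mul]
      simp only [hH, Matrix.mul_sum]
      simp only [Matrix.smul_mul, Matrix.mul_smul, smul_smul, D.map_mul]
      simp only [mul_comm]
    rw [hprod]
    simp only [map_sum, map_smul, Matrix.sum_apply, Matrix.smul_apply, smul_eq_mul, D.map_mul]
    rfl
  simp only [hK]
  rw [Finset.sum_comm]
  simp_rw [Finset.sum_comm (s := (Finset.univ : Finset ι)), ← Finset.mul_sum, hdet]
  rw [Finset.sum_eq_single s, Matrix.mul_apply]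
  · refine Finset.sum_congr rfl fun t _ => ?_
    rw [Finset.sum_eq_single t, Finset.sum_eq_single u]
    · simp
    · intro u' _ hu; simp [hu]
    · simp
    · intro t' _ ht; simp [ht]
    · simp
  · intro s' _ hs; simp [hs]
  · simp

/-! ### Powers of a triple -/

theorem TripleProductProperty.rotate {G : Type*} [Group G] {S₁ S₂ S₃ : Finset G}
    (h : TripleProductProperty S₁ S₂ S₃) : TripleProductProperty S₂ S₃ S₁ := by
  intro q₁ h₁ q₂ h₂ q₃ h₃ hq
  obtain ⟨a, b, c⟩ := h q₃ h₃ q₁ h₁ q₂ h₂ (by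
    rwa [mul_assoc, mul_eq_one_comm])
  exact ⟨b, c, a⟩

theorem TripleProductProperty.pi {G J : Type*} [Group G] [Fintype J] [DecidableEq J]
    {S₁ S₂ S₃ : J → Finset G} (h : ∀ j, TripleProductProperty (S₁ j) (S₂ j) (S₃ j)) :
    TripleProductProperty (Fintype.piFinset S₁) (Fintype.piFinset S₂) (Fintype.piFinset S₃) := by
  have hQ : ∀ (S : J → Finset G) (q : J → G), q ∈ rightQuotientSet (Fintype.piFinset S) →
      ∀ j, q j ∈ rightQuotientSet (S j) := by
    rintro S q ⟨a, ha, b, hb, rfl⟩ j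
    exact ⟨a j, Fintype.mem_piFinset.1 ha j, b j, Fintype.mem_piFinset.1 hb j, rfl⟩
  intro q₁ h₁ q₂ h₂ q₃ h₃ hq
  have := fun j => h j _ (hQ _ _ h₁ j) _ (hQ _ _ h₂ j) _ (hQ _ _ h₃ j) (congrFun hq j)
  exact ⟨funext fun j => (this j).1, funext fun j => (this j).2.1, funext fun j => (this j).2.2⟩

/-- The `l`-th power of the symmetrized triple, in the `3 l`-th power of `G`, multiplies square
matrices of size `(nmp) ^ l`. -/
theorem Realizes.matMulRankLE_pow {G : Type*} [Group G] {n m p : ℕ} (h : Realizes G n m p)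
    {ι : Type*} [Fintype ι] {κ : ι → Type*} [∀ i, Fintype (κ i)] (D : DetectingReps G κ) (l : ℕ)
    {r : (Fin 3 × Fin l → ι) → ℕ} (hr : ∀ I, MatMulRankLE (∀ j, κ (I j)) (r I)) :
    MatMulRankLE (Fin ((n * m * p) ^ l)) (∑ I, r I) := by
  classical
  obtain ⟨S₁, S₂, S₃, h1, h2, h3, h⟩ := h
  -- Each product set uses all three subsets equally often, so all have size $(nmp)^l$.
  let T₁ : Fin 3 × Fin l → Finset G := fun j => ![S₁, S₂, S₃] j.1
  let T₂ : Fin 3 × Fin l → Finset G := fun j => ![S₂, S₃, S₁] j.1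
  let T₃ : Fin 3 × Fin l → Finset G := fun j => ![S₃, S₁, S₂] j.1
  have hT : TripleProductProperty (Fintype.piFinset T₁) (Fintype.piFinset T₂)
      (Fintype.piFinset T₃) := TripleProductProperty.pi fun ⟨j, k⟩ => by
    fin_cases j
    exacts [h, h.rotate, h.rotate.rotate]
  have hR := hT.bilinRankLE (D.pi (Fin 3 × Fin l)) hr
  have e : ∀ T : Fin 3 × Fin l → Finset G, (Fintype.piFinset T).card = (n * m * p) ^ l →
      Nonempty (Fin ((n * m * p) ^ l) ≃ Fintype.piFinset T) := fun T hT =>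
    ⟨Fintype.equivOfCardEq (by simpa using hT.symm)⟩
  obtain ⟨e₁⟩ := e T₁ (by
    simp [T₁, Fintype.card_piFinset, Fintype.prod_prod_type, Fin.prod_univ_three, h1, h2, h3,
      mul_pow])
  obtain ⟨e₂⟩ := e T₂ (by
    simp [T₂, Fintype.card_piFinset, Fintype.prod_prod_type, Fin.prod_univ_three, h1, h2, h3,
      mul_pow]; ring)
  obtain ⟨e₃⟩ := e T₃ (by
    simp [T₃, Fintype.card_piFinset, Fintype.prod_prod_type, Fin.prod_univ_three, h1, h2, h3,
      mul_pow]; ring)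
  have := hR.comp (Matrix.reindexLinearEquiv ℂ ℂ e₁ e₂).toLinearMap
    (Matrix.reindexLinearEquiv ℂ ℂ e₂ e₃).toLinearMap
    (Matrix.reindexLinearEquiv ℂ ℂ e₁.symm e₃.symm).toLinearMap
  unfold MatMulRankLE
  convert this using 3 with A B
  ext i j
  simp [Matrix.mul_apply, ← e₂.symm.sum_comp]

/-! ### Bounds from counting -/

/-- The map $(s,t)\mapsto s^{-1}t$ is injective: take the third quotient to be 1. -/
theorem TripleProductProperty.card_mul_card_le {G : Type*} [Group G] [Finite G]
    {S₁ S₂ S₃ : Finset G} (h : TripleProductProperty S₁ S₂ S₃) (h₃ : S₃.Nonempty) :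
    S₁.card * S₂.card ≤ Nat.card G := by
  classical
  have := Fintype.ofFinite G
  obtain ⟨u, hu⟩ := h₃
  rw [Nat.card_eq_fintype_card, ← Finset.card_product, ← Finset.card_univ]
  refine Finset.card_le_card_of_injOn (fun x => x.1⁻¹ * x.2) (fun _ _ => Finset.mem_univ _) ?_
  rintro ⟨s, t⟩ hx ⟨s', t'⟩ hy hxy
  simp only [Finset.coe_product, Set.mem_prod, Finset.mem_coe] at hx hy hxy
  obtain ⟨a, b, -⟩ := h (s' * s⁻¹) ⟨_, hy.1, _, hx.1, rfl⟩ (t * t'⁻¹) ⟨_, hx.2, _, hy.2, rfl⟩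
    1 ⟨u, hu, u, hu, by simp⟩ (by
      rw [mul_one, mul_assoc, ← mul_assoc s⁻¹, hxy]; group)
  rw [mul_inv_eq_one] at a b
  rw [a, b]

theorem Realizes.sq_le {G : Type*} [Group G] [Finite G] {n m p : ℕ} (h : Realizes G n m p)
    (hpos : 0 < n * m * p) : (n * m * p) ^ 2 ≤ Nat.card G ^ 3 := by
  obtain ⟨S₁, S₂, S₃, rfl, rfl, rfl, h⟩ := h
  have h1 : S₁.Nonempty := Finset.card_pos.1 (Nat.pos_of_ne_zero (by rintro h; simp [h] at hpos))
  have h2 : S₂.Nonempty := Finset.card_pos.1 (Nat.pos_of_ne_zero (by rintro h; simp [h] at hpos))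
  have h3 : S₃.Nonempty := Finset.card_pos.1 (Nat.pos_of_ne_zero (by rintro h; simp [h] at hpos))
  calc (S₁.card * S₂.card * S₃.card) ^ 2
      = (S₁.card * S₂.card) * (S₂.card * S₃.card) * (S₃.card * S₁.card) := by ring
    _ ≤ Nat.card G * Nat.card G * Nat.card G := by
      gcongr
      exacts [h.card_mul_card_le h3, h.rotate.card_mul_card_le h1,
        h.rotate.rotate.card_mul_card_le h2]
    _ = _ := by ring

/-- In a commutative group the map $(s,t,u)\mapsto stu$ is injective. -/
theorem Realizes.le_of_comm {G : Type*} [CommGroup G] [Finite G]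
    {n m p : ℕ} (h : Realizes G n m p) : n * m * p ≤ Nat.card G := by
  classical
  have := Fintype.ofFinite G
  obtain ⟨S₁, S₂, S₃, rfl, rfl, rfl, h⟩ := h
  rw [Nat.card_eq_fintype_card, ← Finset.card_product, ← Finset.card_product, ← Finset.card_univ]
  refine Finset.card_le_card_of_injOn (fun x => x.1.1 * x.1.2 * x.2)
    (fun _ _ => Finset.mem_univ _) ?_
  rintro ⟨⟨s, t⟩, u⟩ hx ⟨⟨s', t'⟩, u'⟩ hy hxy
  simp only [Finset.coe_product, Set.mem_prod, Finset.mem_coe] at hx hy hxy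
  obtain ⟨a, b, c⟩ := h (s * s'⁻¹) ⟨_, hx.1.1, _, hy.1.1, rfl⟩ (t * t'⁻¹)
    ⟨_, hx.1.2, _, hy.1.2, rfl⟩ (u * u'⁻¹) ⟨_, hx.2, _, hy.2, rfl⟩ (by
      rw [mul_mul_mul_comm s, ← mul_inv, mul_mul_mul_comm (s * t), ← mul_inv, hxy, mul_inv_cancel])
  rw [mul_inv_eq_one] at a b c
  rw [a, b, c]

/-! ### Wedderburn decomposition of the group algebra -/

theorem mem_characterDegrees_of_surjective {G : Type*} [Group G] {d : ℕ} (hd : d ≠ 0)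
    (f : MonoidAlgebra ℂ G →ₐ[ℂ] Matrix (Fin d) (Fin d) ℂ) (hf : Function.Surjective f) :
    d ∈ characterDegrees G := by
  classical
  have : NeZero d := ⟨hd⟩
  let ρ : Representation ℂ G (Fin d → ℂ) :=
    ((Matrix.toLinAlgEquiv' : Matrix (Fin d) (Fin d) ℂ ≃ₐ[ℂ] _).toAlgHom.comp f :
      MonoidAlgebra ℂ G →* _).comp (MonoidAlgebra.of ℂ G)
  have hρ : ∀ g v, ρ g v = (f (MonoidAlgebra.of ℂ G g)).mulVec v := fun g v => rfl
  have hstable : ∀ (W : Subrepresentation ρ) (A : Matrix (Fin d) (Fin d) ℂ) (v : Fin d → ℂ),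
      v ∈ W.toSubmodule → A.mulVec v ∈ W.toSubmodule := by
    intro W A v hv
    obtain ⟨x, rfl⟩ := hf A
    induction x using MonoidAlgebra.induction_on with
    | of g => exact W.apply_mem_toSubmodule g hv
    | add x y hx hy => rw [map_add, Matrix.add_mulVec]; exact add_mem hx hy
    | smul c x hx => rw [map_smul, Matrix.smul_mulVec]; exact Submodule.smul_mem _ _ hx
  have hbt : ∀ W : Subrepresentation ρ, W.toSubmodule = ⊥ ∨ W.toSubmodule = ⊤ := by
    intro W
    refine or_iff_not_imp_left.2 fun hW => ?_
    obtain ⟨v, hv, hv0⟩ := Submodule.exists_mem_ne_zero_of_ne_bot hW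
    obtain ⟨j, hj⟩ := Function.ne_iff.1 hv0
    refine Submodule.eq_top_iff'.2 fun w => ?_
    -- This rank-one matrix sends `v` to `w`; surjectivity of `f` makes `W` stable under all
    -- matrices.
    have := hstable W (Matrix.of fun i k => if k = j then w i / v j else 0) v hv
    convert this using 1
    funext i
    simp only [Pi.zero_apply, ne_eq] at hj
    simp [Matrix.mulVec, dotProduct, hj]
  refine ⟨ρ, { exists_pair_ne := ⟨⊥, ⊤, fun h => ?_⟩, eq_bot_or_eq_top := fun W => ?_ }⟩
  · have h' : (⊥ : Submodule ℂ (Fin d → ℂ)) = ⊤ := congrArg Subrepresentation.toSubmodule h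
    exact bot_ne_top h'
  · exact (hbt W).imp (fun h => Subrepresentation.toSubmodule_injective h)
      fun h => Subrepresentation.toSubmodule_injective h

theorem exists_detectingReps (G : Type*) [Group G] [Finite G] :
    ∃ (k : ℕ) (d : Fin k → ℕ), (∀ i, d i ≠ 0) ∧ (∀ i, d i ∈ characterDegrees G) ∧
      ∑ i, d i ^ 2 = Nat.card G ∧ Nonempty (DetectingReps G fun i => Fin (d i)) := by
  classical
  have := Fintype.ofFinite G
  have : NeZero (Nat.card G : ℂ) := ⟨by exact_mod_cast Nat.card_pos.ne'⟩
  obtain ⟨k, d, hd, ⟨e⟩⟩ :=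
    IsSemisimpleRing.exists_algEquiv_pi_matrix_of_isAlgClosed ℂ (MonoidAlgebra ℂ G)
  refine ⟨k, d, fun i => (hd i).out, fun i => mem_characterDegrees_of_surjective (hd i).out
    ((Pi.evalAlgHom ℂ _ i).comp e.toAlgHom) ?_, ?_, ?_⟩
  · exact (Function.surjective_eval i).comp e.surjective
  · have h := e.toLinearEquiv.finrank_eq
    rw [Module.finrank_pi_fintype] at h
    simp only [Module.finrank_matrix, Fintype.card_fin, Module.finrank_self, mul_one] at h
    have h2 : Module.finrank ℂ (MonoidAlgebra ℂ G) = Nat.card G := by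
      rw [(MonoidAlgebra.coeffLinearEquiv (M := G) (S := ℂ) ℂ).finrank_eq,
        Module.finrank_finsupp_self, Nat.card_eq_fintype_card]
    rw [← h2, h]
    exact Finset.sum_congr rfl fun i _ => pow_two _
  -- The coefficient at the identity of $G$, carried to the matrix side; its values on matrix units
  -- are the detecting coefficients.
  · let L : (∀ i, Matrix (Fin (d i)) (Fin (d i)) ℂ) →ₗ[ℂ] ℂ :=
      Finsupp.lapply (1 : G) ∘ₗ (MonoidAlgebra.coeffLinearEquiv ℂ).toLinearMap ∘ₗ
        e.symm.toLinearMap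
    have hL : ∀ Z, ∑ i, ∑ a, ∑ b, L (LinearMap.single ℂ _ i (Matrix.single a b 1)) * Z i a b =
        L Z := by
      intro Z
      conv_rhs => rw [← Finset.univ_sum_single Z, map_sum]
      refine Finset.sum_congr rfl fun i _ => ?_
      conv_rhs => rw [Matrix.matrix_eq_sum_single (Z i), ← LinearMap.single_apply (R := ℂ)]
      simp only [map_sum]
      refine Finset.sum_congr rfl fun a _ => Finset.sum_congr rfl fun b _ => ?_
      rw [mul_comm, ← smul_eq_mul, ← map_smul, ← map_smul, Matrix.smul_single, smul_eq_mul,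
        mul_one]
    have hone : ∀ g : G, L (e (MonoidAlgebra.of ℂ G g)) = if g = 1 then 1 else 0 := by
      intro g
      simp [L, Finsupp.single_apply]
    exact ⟨{
      toFun := fun i g => e (MonoidAlgebra.of ℂ G g) i
      map_mul := fun i g h => by simp only [map_mul, Pi.mul_apply]
      coeff := fun i a b => L (LinearMap.single ℂ _ i (Matrix.single a b 1))
      sum_coeff_one := by rw [hL, hone, if_pos rfl]
      sum_coeff_of_ne := fun g hg => by rw [hL, hone, if_neg hg] }⟩

/-! ### The exponent bound -/

/-- One constant serves all sizes, so tensor powers do not raise it to a power. -/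
theorem exists_matMulRankLE_of_mem_matMulExponents {τ : ℝ} (hτ : τ ∈ matMulExponents) :
    ∃ C : ℝ, ∀ (κ : Type) [Fintype κ] [Nonempty κ],
      ∃ r : ℕ, (r : ℝ) ≤ C * (Fintype.card κ : ℝ) ^ τ ∧ MatMulRankLE κ r := by
  obtain ⟨C, hC⟩ := hτ
  refine ⟨2 * C, fun κ _ _ => ?_⟩
  obtain ⟨s, hs, h⟩ := hC (Fintype.card κ) Fintype.card_pos
  refine ⟨2 * s, ?_, h.matMulRankLE.of_equiv (Fintype.equivFin κ)⟩
  push_cast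
  linarith

/-- If $E<a$, dividing by $a^l$ makes the right side tend to 0 while the left side stays 1. -/
theorem le_of_forall_pow_le {a b E K : ℝ} (hb : 1 ≤ b) (hab : b < a) (hE : 0 ≤ E)
    (h : ∀ l : ℕ, 1 ≤ l → a ^ l ≤ K * E ^ l + b ^ l + 1) : a ≤ E := by
  by_contra! hEa
  have ha : 0 < a := by linarith
  have ht : ∀ c : ℝ, 0 ≤ c → c < a →
      Filter.Tendsto (fun l : ℕ => (c / a) ^ l) Filter.atTop (nhds 0) := fun c hc hca =>
    tendsto_pow_atTop_nhds_zero_of_lt_one (by positivity) ((div_lt_one ha).2 hca)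
  have hlim := (((ht E hE hEa).const_mul K).add (ht b (by linarith) hab)).add
    (ht 1 zero_le_one (by linarith))
  simp only [mul_zero, add_zero] at hlim
  obtain ⟨l, h1, h2⟩ := ((hlim.eventually (gt_mem_nhds one_pos)).and
    (Filter.eventually_ge_atTop 1)).exists
  have hal : 0 < a ^ l := by positivity
  rw [div_pow, div_pow, div_pow, one_pow, ← mul_div_assoc, ← add_div, ← add_div,
    div_lt_one hal] at h1
  exact absurd (h l h2) (not_le.2 h1)

theorem matMulExponent_le_of_mem {τ : ℝ} (hτ : τ ∈ matMulExponents) : matMulExponent ≤ τ :=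
  csInf_le bddBelow_matMulExponents hτ

/-- The inequality `(nmp) ^ ω ≤ (∑ dᵢ ^ τ) ^ 3` for `τ` an admissible exponent. -/
theorem Realizes.rpow_matMulExponent_le {G : Type*} [Group G] {n m p : ℕ}
    (h : Realizes G n m p) (hM : 1 < n * m * p) {k : ℕ} {d : Fin k → ℕ} (hd : ∀ i, d i ≠ 0)
    (D : DetectingReps G fun i => Fin (d i)) {τ : ℝ} (hτ : τ ∈ matMulExponents)
    (hω : 2 < matMulExponent) :
    ((n * m * p : ℕ) : ℝ) ^ matMulExponent ≤ (∑ i, (d i : ℝ) ^ τ) ^ 3 := by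
  obtain ⟨C, hC⟩ := exists_matMulRankLE_of_mem_matMulExponents hτ
  set M := n * m * p with hMdef
  have hM1 : (1 : ℝ) < M := by exact_mod_cast hM
  have hne : ∀ i, Nonempty (Fin (d i)) := fun i => ⟨⟨0, Nat.pos_of_ne_zero (hd i)⟩⟩
  refine le_of_forall_pow_le (b := (M : ℝ) ^ 2) (K := C) (one_le_pow₀ hM1.le) ?_
    (pow_nonneg (Finset.sum_nonneg fun i _ => by positivity) 3) fun l hl => ?_
  · rw [← Real.rpow_natCast]
    exact Real.rpow_lt_rpow_of_exponent_lt hM1 (by exact_mod_cast hω)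
  choose r hr hrank using fun I : Fin 3 × Fin l → Fin k => hC (∀ j, Fin (d (I j)))
  -- The rank bound is padded to meet the requirement of the recursion; the padding is negligible
  -- against $M^{\omega l}$ because $\omega>2$.
  have hR : MatMulRankLE (Fin (M ^ l)) (∑ I, r I + ((M ^ l) ^ 2 + 1)) :=
    (h.matMulRankLE_pow D l hrank).mono (by omega)
  have hMl : 2 ≤ M ^ l := le_trans (by omega) (Nat.le_self_pow (by omega) M)
  have hlog := matMulExponent_le_of_mem (hR.logb_mem_matMulExponents hMl (by omega))
  have hsum : ((∑ I, r I : ℕ) : ℝ) ≤ C * ((∑ i, (d i : ℝ) ^ τ) ^ 3) ^ l := by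
    have hprod : ∑ I : Fin 3 × Fin l → Fin k, ∏ j, (d (I j) : ℝ) ^ τ =
        ((∑ i, (d i : ℝ) ^ τ) ^ 3) ^ l := by
      have := Finset.prod_univ_sum (fun _ : Fin 3 × Fin l => (Finset.univ : Finset (Fin k)))
        (fun _ i => (d i : ℝ) ^ τ)
      rw [Fintype.piFinset_univ] at this
      rw [← this, Finset.prod_const, ← pow_mul]
      simp
    rw [← hprod, Finset.mul_sum]
    push_cast
    refine Finset.sum_le_sum fun I _ => (hr I).trans_eq ?_
    rw [Real.finsetProd_rpow _ _ fun j _ => by positivity]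
    simp
  have hMl1 : (1 : ℝ) < (M ^ l : ℕ) := by exact_mod_cast (by omega : 1 < M ^ l)
  rw [Real.le_logb_iff_rpow_le hMl1 (by positivity)] at hlog
  calc ((M : ℝ) ^ matMulExponent) ^ l = ((M ^ l : ℕ) : ℝ) ^ matMulExponent := by
        push_cast
        rw [← Real.rpow_natCast, ← Real.rpow_natCast, ← Real.rpow_mul (by positivity),
          ← Real.rpow_mul (by positivity), mul_comm]
    _ ≤ _ := hlog
    _ ≤ _ := by
      push_cast at hsum ⊢
      rw [← pow_mul, mul_comm l 2, pow_mul]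
      linarith

theorem Realizes.matMulExponent_mul_log_le {G : Type*} [Group G] [Finite G] {n m p : ℕ}
    (h : Realizes G n m p) (hM : 1 < n * m * p) (hω : 2 < matMulExponent)
    (hdeg : 1 < maxCharacterDegree G) :
    matMulExponent * Real.log ((n * m * p : ℕ) : ℝ) ≤
      3 * ((matMulExponent - 2) * Real.log (maxCharacterDegree G) + Real.log (Nat.card G)) := by
  obtain ⟨k, d, hd, hchar, hsq, ⟨D⟩⟩ := exists_detectingReps G
  have hx : 0 < Real.log (maxCharacterDegree G) := Real.log_pos (by exact_mod_cast hdeg)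
  have hG : (0 : ℝ) < Nat.card G := by exact_mod_cast Nat.card_pos
  have hmax : (0 : ℝ) < maxCharacterDegree G := by exact_mod_cast (by omega)
  have hM0 : (0 : ℝ) < (n * m * p : ℕ) := by exact_mod_cast (by omega)
  have key : ∀ τ ∈ matMulExponents, matMulExponent * Real.log ((n * m * p : ℕ) : ℝ) ≤
      3 * ((τ - 2) * Real.log (maxCharacterDegree G) + Real.log (Nat.card G)) := by
    intro τ hτ
    have hτ2 : 2 < τ := hω.trans_le (matMulExponent_le_of_mem hτ)
    have hsum : ∑ i, (d i : ℝ) ^ τ ≤ (maxCharacterDegree G : ℝ) ^ (τ - 2) * Nat.card G := by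
      rw [← hsq]
      push_cast
      rw [Finset.mul_sum]
      refine Finset.sum_le_sum fun i _ => ?_
      have hi : (0 : ℝ) < d i := by exact_mod_cast Nat.pos_of_ne_zero (hd i)
      have hle : (d i : ℝ) ≤ maxCharacterDegree G := by
        exact_mod_cast le_csSup (bddAbove_characterDegrees G) (hchar i)
      calc (d i : ℝ) ^ τ = (d i : ℝ) ^ (τ - 2) * (d i : ℝ) ^ 2 := by
            rw [← Real.rpow_natCast, ← Real.rpow_add hi]
            norm_num
        _ ≤ _ := by
            gcongr
    have h1 := (h.rpow_matMulExponent_le hM hd D hτ hω).trans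
      (pow_le_pow_left₀ (Finset.sum_nonneg fun i _ => by positivity) hsum 3)
    have h2 := Real.log_le_log (by positivity) h1
    rw [Real.log_rpow hM0, Real.log_pow, Real.log_mul (by positivity) hG.ne',
      Real.log_rpow hmax] at h2
    exact_mod_cast h2
  -- The infimum $\omega$ need not be attained, so `key` is solved for `τ` and read as a lower bound
  -- for all admissible exponents.
  have hinf : (matMulExponent * Real.log ((n * m * p : ℕ) : ℝ) / 3 - Real.log (Nat.card G)) /
      Real.log (maxCharacterDegree G) + 2 ≤ matMulExponent := by
    refine le_csInf ⟨3, three_mem_matMulExponents⟩ fun τ hτ => ?_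
    rw [← le_sub_iff_add_le, div_le_iff₀ hx]
    linarith [key τ hτ]
  rw [← le_sub_iff_add_le, div_le_iff₀ hx] at hinf
  linarith

/-! ### Lower bounds for the pseudo-exponent -/

theorem two_le_pseudoExponent (G : Type*) [Group G] [Finite G] : 2 ≤ pseudoExponent G := by
  by_cases hnt : Nontrivial G
  · obtain ⟨n, m, p, hM, h, heq⟩ := (pseudoExponent_isLeast G).1
    have hsq := h.sq_le (by omega)
    have hM0 : (0 : ℝ) < (n * m * p : ℕ) := by exact_mod_cast (by omega)
    have hlog : 0 < Real.log ((n * m * p : ℕ) : ℝ) := Real.log_pos (by exact_mod_cast hM)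
    have := Real.log_le_log (by positivity)
      (show ((n * m * p : ℕ) : ℝ) ^ 2 ≤ (Nat.card G : ℝ) ^ 3 by exact_mod_cast hsq)
    rw [Real.log_pow, Real.log_pow] at this
    rw [heq, le_div_iff₀ hlog]
    exact_mod_cast this
  · rw [pseudoExponent, if_neg hnt]
    norm_num

theorem three_le_pseudoExponent_of_comm (G : Type*) [CommGroup G] [Finite G] :
    3 ≤ pseudoExponent G := by
  by_cases hnt : Nontrivial G
  · obtain ⟨n, m, p, hM, h, heq⟩ := (pseudoExponent_isLeast G).1
    have hM0 : (0 : ℝ) < (n * m * p : ℕ) := by exact_mod_cast (by omega)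
    have hlog : 0 < Real.log ((n * m * p : ℕ) : ℝ) := Real.log_pos (by exact_mod_cast hM)
    have := Real.log_le_log hM0
      (show ((n * m * p : ℕ) : ℝ) ≤ Nat.card G by exact_mod_cast h.le_of_comm)
    rw [heq, le_div_iff₀ hlog]
    linarith
  · rw [pseudoExponent, if_neg hnt]

theorem mainTheorem3 (G : Type*) [Group G] [Finite G]
    (h : (pseudoExponent G : EReal) < degreeExponent G) :
    (degreeExponent G ≠ ⊤ →
      matMulExponent ≤ pseudoExponent G *
        (((degreeExponent G).toReal - 2) / ((degreeExponent G).toReal - pseudoExponent G))) ∧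
    (degreeExponent G = ⊤ → matMulExponent ≤ pseudoExponent G) := by
  by_cases hG : ∀ a b : G, a * b = b * a
  · refine ⟨fun hne => absurd (if_pos hG) hne, fun _ => ?_⟩
    exact (matMulExponent_le_of_mem three_mem_matMulExponents).trans
      (@three_le_pseudoExponent_of_comm G { (inferInstance : Group G) with mul_comm := hG } _)
  have hγ : degreeExponent G =
      ((Real.log (Nat.card G) / Real.log (maxCharacterDegree G) : ℝ) : EReal) := if_neg hG
  refine ⟨fun _ => ?_, fun htop => absurd (hγ.symm.trans htop) (EReal.coe_ne_top _)⟩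
  rw [hγ, EReal.coe_lt_coe_iff] at h
  rw [hγ, EReal.toReal_coe]
  have hα := two_le_pseudoExponent G
  have hnt : Nontrivial G := by
    push Not at hG
    obtain ⟨a, b, hab⟩ := hG
    exact ⟨_, _, hab⟩
  obtain ⟨n, m, p, hM, hR, heq⟩ := (pseudoExponent_isLeast G).1
  have hlogM : 0 < Real.log ((n * m * p : ℕ) : ℝ) := Real.log_pos (by exact_mod_cast hM)
  have hg : 0 < Real.log (Nat.card G) :=
    Real.log_pos (by exact_mod_cast Finite.one_lt_card (α := G))
  -- A zero logarithm would make the quotient $\gamma$ equal 0 by convention, contradicting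
  -- $2\le\alpha<\gamma$.
  have hx0 : Real.log (maxCharacterDegree G) ≠ 0 := fun h0 => by
    rw [h0, div_zero] at h
    linarith
  have hdeg : 1 < maxCharacterDegree G := by
    by_contra! hle
    interval_cases maxCharacterDegree G <;> simp at hx0
  have hx : 0 < Real.log (maxCharacterDegree G) := Real.log_pos (by exact_mod_cast hdeg)
  have hbound := hR.matMulExponent_mul_log_le hM
  set α := pseudoExponent G
  set x := Real.log (maxCharacterDegree G)
  set g := Real.log (Nat.card G)
  set L := Real.log ((n * m * p : ℕ) : ℝ)
  set γ := g / x with hγ'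
  rw [← mul_div_assoc, le_div_iff₀ (by linarith)]
  rcases le_or_gt matMulExponent 2 with hω | hω
  -- For $\omega\le2$ one has $\alpha(\gamma-2)-\omega(\gamma-\alpha)\ge(\alpha-2)\gamma\ge0$.
  · nlinarith
  · have h1 := hbound hω hdeg
    have hαL : α * L = 3 * g := by rw [heq, div_mul_cancel₀ _ hlogM.ne']
    have hγx : γ * x = g := div_mul_cancel₀ _ hx0
    have h2 : matMulExponent * (γ * x) ≤ α * ((matMulExponent - 2) * x + γ * x) := by
      rw [hγx]
      have := mul_le_mul_of_nonneg_left h1 (by linarith : 0 ≤ α)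
      have h3 : α * (matMulExponent * L) = matMulExponent * (3 * g) := by rw [← hαL]; ring
      linarith
    have h4 : (matMulExponent * (γ - α)) * x ≤ (α * (γ - 2)) * x := by linarith
    exact le_of_mul_le_mul_right h4 hx
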